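/- An effective approximation of a real $x$ is a sequence $(q_n)_{n\in\mathbb N}$ of rationals with $|q_n-q_{n+1}|<2^{-n}$ for all $n$ and $\lim_n q_n=x$. A real function $f$ is computable on a set $X\subseteq\mathrm{dom}(f)$ if there is a single oracle Turing machine that, for every $x\in X$ and every effective approximation of $x$ given as an oracle (rationals being finitely encoded), outputs an effective approximation of $f(x)$. For reals $\alpha$ and $\beta>0$, write $\alpha\le_{\mathrm{cl}}^{\mathrm{open}}\beta$ if there is a real function $f$ that is computable and Lipschitz continuous on $[0,\beta)$ and satisfies $\lim_{x\nearrow\beta}f(x)=\alpha$. For reals $\alpha$ and $\beta\ge 0$, write $\alpha\le_{\mathrm{cl}}^{\mathrm{loc}}\beta$ if there are a real $b>\beta$ and a real function $f$ that is computable and Lipschitz continuous on $[0,b]$ and satisfies $f(\beta)=\alpha$. A Martin-Löf test is a sequence $(U_n)_{n\in\mathbb N}$ of uniformly c.e. open subsets of $\mathbb R$ (that is, $U_n=\bigcup_k (l_{n,k},r_{n,k})$ with rational endpoints computable from $n,k$) with Lebesgue measure $\mu(U_n)\le 2^{-n}$ for all $n$; it is a Schnorr test if, in addition, the reals $\mu(U_n)$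 are computable uniformly in $n$. A real $x$ is Martin-Löf random (Schnorr random) if $x\notin\bigcap_n U_n$ for every Martin-Löf test (Schnorr test) $(U_n)$. Proposition. The set of Martin-Löf random reals is $\le_{\mathrm{cl}}^{\mathrm{open}}$-closed upwards, and the set of Schnorr random reals is $\le_{\mathrm{cl}}^{\mathrm{loc}}$-closed upwards. That is: (a) For all reals $\alpha$ and $\beta>0$: if $\alpha\le_{\mathrm{cl}}^{\mathrm{open}}\beta$ and $\beta$ is not Martin-Löf random, then $\alpha$ is not Martin-Löf random. (b) For all reals $\alpha$ and $\beta\ge 0$: if $\alpha\le_{\mathrm{cl}}^{\mathrm{loc}}\beta$ and $\beta$ is not Schnorr random, then $\alpha$ is not Schnorr random. -/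

import Mathlib

open Filter Topology MeasureTheory
open scoped NNReal ENNReal

namespace SolovayVariants

/-! ### Finite encoding of rationals -/

/-- The standard numbering of the rationals: the natural number coding the triple `(a, b, c)`
is a code of the rational `(a - b) / (c + 1)`. Every rational has a code. -/
def ratOfCode (n : ℕ) : ℚ :=
  ((n.unpair.1 : ℚ) - (n.unpair.2.unpair.1 : ℚ)) / ((n.unpair.2.unpair.2 : ℚ) + 1)

theorem ratOfCode_surjective : Function.Surjective ratOfCode := by
  intro q
  refine ⟨Nat.pair q.num.toNat (Nat.pair (-q.num).toNat (q.den - 1)), ?_⟩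
  have h1 : ((q.num.toNat : ℤ) : ℚ) - (((-q.num).toNat : ℤ) : ℚ) = (q.num : ℚ) := by
    rw [← Int.cast_sub, Int.toNat_sub_toNat_neg]
  have h2 : ((q.den - 1 : ℕ) : ℚ) + 1 = q.den := by
    have := q.pos
    rw [← Nat.cast_succ, Nat.succ_eq_add_one, Nat.sub_add_cancel this]
  simp only [ratOfCode, Nat.unpair_pair]
  rw [h2]
  simp only [Int.cast_natCast] at h1
  rw [h1, Rat.num_div_den]

/-! ### Oracle machines -/

/-- Programs of oracle machines on the natural numbers, in the form of descriptions of partial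
recursive functionals. (One program is run on many oracles, so the program is a datum
that does not depend on the oracle.) -/
inductive OracleCode : Type
  | zero : OracleCode
  | succ : OracleCode
  | left : OracleCode
  | right : OracleCode
  | oracle : OracleCode
  | pair : OracleCode → OracleCode → OracleCode
  | comp : OracleCode → OracleCode → OracleCode
  | prec : OracleCode → OracleCode → OracleCode
  | rfind : OracleCode → OracleCode

/-- The partial function computed by an oracle program with the oracle `O`. The clauses are the
ones of `Nat.RecursiveIn {O}`. -/
def OracleCode.eval (O : ℕ → ℕ) : OracleCode → ℕ →. ℕ
  | .zero => fun _ => Part.some 0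
  | .succ => fun n => Part.some (n + 1)
  | .left => fun n => Part.some n.unpair.1
  | .right => fun n => Part.some n.unpair.2
  | .oracle => fun n => Part.some (O n)
  | .pair c d => fun n => Nat.pair <$> c.eval O n <*> d.eval O n
  | .comp c d => fun n => d.eval O n >>= c.eval O
  | .prec c d => fun p =>
      p.unpair.2.rec (c.eval O p.unpair.1) fun y IH =>
        IH >>= fun i => d.eval O (Nat.pair p.unpair.1 (Nat.pair y i))
  | .rfind c => fun a =>
      Nat.rfind fun n => (fun m => decide (m = 0)) <$> c.eval O (Nat.pair a n)

/-- The machine `M`, given the sequence of rationals coded by `p` as an oracle, returns the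
infinite sequence of rationals coded by `q`. -/
def OracleCode.Returns (M : OracleCode) (p q : ℕ → ℕ) : Prop :=
  ∀ n, q n ∈ M.eval p n

/-! ### Computable real functions -/

/-- `q₀, q₁, …` is an effective approximation of the real `x`. -/
def IsEffectiveApprox (q : ℕ → ℚ) (x : ℝ) : Prop :=
  (∀ n, |q n - q (n + 1)| < (2⁻¹ : ℚ) ^ n) ∧ Tendsto (fun n => (q n : ℝ)) atTop (𝓝 x)

/-- The real function `f` is (Type 2) computable on the set `X`: one oracle machine turns every
effective approximation of every `x ∈ X` into an effective approximation of `f x`. -/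
def ComputableRealOn (f : ℝ → ℝ) (X : Set ℝ) : Prop :=
  ∃ M : OracleCode, ∀ x ∈ X, ∀ p : ℕ → ℕ, IsEffectiveApprox (fun n => ratOfCode (p n)) x →
    ∃ q : ℕ → ℕ, M.Returns p q ∧ IsEffectiveApprox (fun n => ratOfCode (q n)) (f x)

/-! ### The two reducibilities

Only the values of `f` on the stated interval matter, so a partial real function defined there is
represented by an arbitrary extension of it to `ℝ`. -/

/-- `f` is a weakly `ℝ`-translation function from `β` to `α` (for `0 < β`). -/
def IsWeakTranslation (f : ℝ → ℝ) (β α : ℝ) : Prop :=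
  ComputableRealOn f (Set.Ico 0 β) ∧ Tendsto f (𝓝[<] β) (𝓝 α)

/-- `α` is computably Lipschitz reducible to `β` on a c.e. open interval. -/
def ClOpenReducible (α β : ℝ) : Prop :=
  ∃ f : ℝ → ℝ, IsWeakTranslation f β α ∧ ∃ K : ℝ≥0, LipschitzOnWith K f (Set.Ico 0 β)

/-- `α` is computably Lipschitz reducible to `β` locally. -/
def ClLocReducible (α β : ℝ) : Prop :=
  ∃ b : ℝ, β < b ∧ ∃ f : ℝ → ℝ, ComputableRealOn f (Set.Icc 0 b) ∧
    (∃ K : ℝ≥0, LipschitzOnWith K f (Set.Icc 0 b)) ∧ f β = α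

/-! ### Martin-Löf and Schnorr randomness -/

/-- `U₀, U₁, …` are uniformly effectively (c.e.) open sets of reals: `Uₙ` is the union of
rational open intervals enumerated computably, uniformly in `n`. (An interval whose left endpoint
is not below its right endpoint is empty.) -/
def UniformlyCEOpen (U : ℕ → Set ℝ) : Prop :=
  ∃ l r : ℕ → ℕ → ℕ, Computable₂ l ∧ Computable₂ r ∧
    ∀ n, U n = ⋃ k, Set.Ioo (ratOfCode (l n k) : ℝ) (ratOfCode (r n k) : ℝ)

/-- Martin-Löf tests. -/
def IsMartinLofTest (U : ℕ → Set ℝ) : Prop :=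
  UniformlyCEOpen U ∧ ∀ n, volume (U n) ≤ (2⁻¹ : ℝ≥0∞) ^ n

/-- The reals `x₀, x₁, …` are uniformly computable. -/
def UniformlyComputable (x : ℕ → ℝ) : Prop :=
  ∃ a : ℕ → ℕ → ℕ, Computable₂ a ∧
    ∀ n i, |x n - (ratOfCode (a n i) : ℝ)| ≤ (2⁻¹ : ℝ) ^ i

/-- Schnorr tests: Martin-Löf tests whose measures are uniformly computable. -/
def IsSchnorrTest (U : ℕ → Set ℝ) : Prop :=
  IsMartinLofTest U ∧ UniformlyComputable fun n => (volume (U n)).toReal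

/-- A real is Martin-Löf random if it passes every Martin-Löf test. -/
def MartinLofRandom (x : ℝ) : Prop :=
  ∀ U : ℕ → Set ℝ, IsMartinLofTest U → x ∉ ⋂ n, U n

/-- A real is Schnorr random if it passes every Schnorr test. -/
def SchnorrRandom (x : ℝ) : Prop :=
  ∀ U : ℕ → Set ℝ, IsSchnorrTest U → x ∉ ⋂ n, U n

end SolovayVariants

/-! An open set given by an enumeration of rational intervals splits, computably in the enumeration,
into disjoint dyadic cells. If `f` is `K`-Lipschitz, then the image of a cell of length `1 / 2 ^ s`
lies in the interval of radius `(K + 3) / 2 ^ s` around an approximation of the value of `f` at a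
rational point of the closure of the cell, so a test that captures `β` is mapped to a uniformly c.e.
sequence of open sets that capture `α`, whose measures have grown by at most the factor
`2 * (K + 3)`. Dropping the first `2 * (K + 3)` sets of the test absorbs this factor. On `[0, β)`
the value of `f` is found only for the cells to the left of `β` or containing it, which is enough
for a Martin-Löf test. If `f` is computable beyond `β`, then every cell can be given a sample point
in the domain of `f`. The same factor then bounds the measure that the image cover gains from all
but finitely many cells by the measure of these cells, which is computable for a Schnorr test, and
the measure of a finite union of intervals is computed by counting the cells of a fine grid inside
it. -/

namespace SolovayVariants

/-! ### Computable functions and predicates -/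

section Computability

variable {α σ : Type*} [Primcodable α] [Primcodable σ]

theorem computable_add {f g : α → ℕ} (hf : Computable f) (hg : Computable g) :
    Computable fun a => f a + g a :=
  Primrec.nat_add.to_comp.comp hf hg

theorem computable_mul {f g : α → ℕ} (hf : Computable f) (hg : Computable g) :
    Computable fun a => f a * g a :=
  Primrec.nat_mul.to_comp.comp hf hg

theorem computable_pair {f g : α → ℕ} (hf : Computable f) (hg : Computable g) :
    Computable fun a => Nat.pair (f a) (g a) :=
  Primrec₂.natPair.to_comp.comp hf hg

theorem computable_unpair_fst {f : α → ℕ} (hf : Computable f) :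
    Computable fun a => (f a).unpair.1 :=
  Computable.fst.comp (Computable.unpair.comp hf)

theorem computable_unpair_snd {f : α → ℕ} (hf : Computable f) :
    Computable fun a => (f a).unpair.2 :=
  Computable.snd.comp (Computable.unpair.comp hf)

theorem computable_two_pow {f : α → ℕ} (hf : Computable f) : Computable fun a => 2 ^ f a :=
  have hpow : Primrec₂ ((· ^ ·) : ℕ → ℕ → ℕ) := Primrec₂.unpaired'.1 Nat.Primrec.pow
  hpow.to_comp.comp (Computable.const 2) hf

theorem computable_ite {p : α → Prop} [DecidablePred p] {f g : α → σ} (hp : ComputablePred p)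
    (hf : Computable f) (hg : Computable g) : Computable fun a => if p a then f a else g a :=
  (Computable.cond hp.decide hf hg).of_eq fun a => Bool.cond_decide (p a) (f a) (g a)

theorem computable_sum_range {f : α → ℕ} {g : α → ℕ → ℕ} (hf : Computable f)
    (hg : Computable₂ g) : Computable fun a => ∑ k ∈ Finset.range (f a), g a k := by
  have hstep : Computable₂ fun (a : α) (p : ℕ × ℕ) => p.2 + g a p.1 :=
    computable_add (Computable.snd.comp Computable.snd)
      (hg.comp Computable.fst (Computable.fst.comp Computable.snd))
  refine (Computable.nat_rec hf (Computable.const 0) hstep).of_eq fun a => ?_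
  induction f a with
  | zero => rfl
  | succ k ih => rw [Finset.sum_range_succ, ← ih]

open Classical in
theorem computable_card_filter_range {f : α → ℕ} {p : α → ℕ → Prop} (hf : Computable f)
    (hp : ComputablePred fun x : α × ℕ => p x.1 x.2) :
    Computable fun a => ((Finset.range (f a)).filter (p a)).card :=
  (computable_sum_range hf
    (computable_ite hp (Computable.const 1) (Computable.const 0)).to₂).of_eq
      fun _ => (Finset.card_filter _ _).symm

theorem computablePred_le {f g : α → ℕ} (hf : Computable f) (hg : Computable g) :
    ComputablePred fun a => f a ≤ g a :=
  Computable.computablePred (Primrec.nat_le.decide.to_comp.comp hf hg)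

theorem computablePred_and {p q : α → Prop} (hp : ComputablePred p) (hq : ComputablePred q) :
    ComputablePred fun a => p a ∧ q a := by
  classical
  exact Computable.computablePred ((Primrec.and.to_comp.comp hp.decide hq.decide).of_eq
    fun a => (Bool.decide_and (p a) (q a)).symm)

theorem computablePred_exists_lt {f : α → ℕ} {p : α → ℕ → Prop} (hf : Computable f)
    (hp : ComputablePred fun x : α × ℕ => p x.1 x.2) :
    ComputablePred fun a => ∃ k < f a, p a k := by
  classical
  refine (computablePred_le (Computable.const 1) (computable_card_filter_range hf hp)).of_eq
    fun a => ?_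
  simp only [Nat.one_le_iff_ne_zero, Finset.card_ne_zero, Finset.Nonempty, Finset.mem_filter,
    Finset.mem_range]

theorem exists_computable_stages {g : α →. σ} (hg : Partrec g) :
    ∃ h : α → ℕ → Option σ, Computable₂ h ∧ ∀ a x, x ∈ g a ↔ ∃ t, h a t = some x := by
  obtain ⟨c, hc⟩ := Nat.Partrec.Code.exists_code.1 hg
  refine ⟨fun a t => (c.evaln t (Encodable.encode a)).bind Encodable.decode, ?_, fun a x => ?_⟩
  · exact Computable.option_bind (Nat.Partrec.Code.primrec_evaln.to_comp.comp
      ((Computable.snd.pair (Computable.const c)).pair (Computable.encode.comp Computable.fst)))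
      (Computable.decode.comp Computable.snd).to₂
  · have hmem : x ∈ g a ↔ Encodable.encode x ∈ c.eval (Encodable.encode a) := by
      simp [hc]
    simp only [hmem, Nat.Partrec.Code.evaln_complete, Option.bind_eq_some_iff]
    refine exists_congr fun t => ⟨fun h => ⟨_, h, Encodable.encodek x⟩, ?_⟩
    rintro ⟨m, hm, hx⟩
    have hmg : m ∈ c.eval (Encodable.encode a) := Nat.Partrec.Code.evaln_sound hm
    rw [hc] at hmg
    obtain ⟨y, -, rfl⟩ : ∃ y ∈ g a, Encodable.encode y = m := by simpa using hmg
    rw [Encodable.encodek, Option.some_inj] at hx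
    rwa [← hx]

end Computability

/-! ### Computable families of rationals -/

/-- A family of rationals is computable if codes of its members are computed by a total
computable function. -/
def ComputableRat {α : Type*} [Primcodable α] (q : α → ℚ) : Prop :=
  ∃ c : α → ℕ, Computable c ∧ ∀ a, ratOfCode (c a) = q a

theorem computable_code_neg {α : Type*} [Primcodable α] {c : α → ℕ} (hc : Computable c) :
    Computable fun a => (c a).unpair.2.unpair.1 :=
  computable_unpair_fst (computable_unpair_snd hc)

theorem computable_code_den {α : Type*} [Primcodable α] {c : α → ℕ} (hc : Computable c) :
    Computable fun a => (c a).unpair.2.unpair.2 + 1 :=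
  Computable.succ.comp (computable_unpair_snd (computable_unpair_snd hc))

theorem ratOfCode_pair (a b d : ℕ) :
    ratOfCode (Nat.pair a (Nat.pair b d)) = (a - b) / (d + 1) := by
  simp only [ratOfCode, Nat.unpair_pair]

theorem ratOfCode_pair_pred (a b : ℕ) {d : ℕ} (hd : 0 < d) :
    ratOfCode (Nat.pair a (Nat.pair b d.pred)) = (a - b) / d := by
  rw [ratOfCode_pair, ← Nat.cast_add_one, ← Nat.succ_eq_add_one, Nat.succ_pred_eq_of_pos hd]

theorem ratOfCode_le_iff (m n : ℕ) : ratOfCode m ≤ ratOfCode n ↔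
    m.unpair.1 * (n.unpair.2.unpair.2 + 1) + n.unpair.2.unpair.1 * (m.unpair.2.unpair.2 + 1) ≤
    n.unpair.1 * (m.unpair.2.unpair.2 + 1) + m.unpair.2.unpair.1 * (n.unpair.2.unpair.2 + 1) := by
  rw [ratOfCode, ratOfCode, div_le_div_iff₀ (by positivity) (by positivity),
    ← Nat.cast_le (α := ℚ)]
  push_cast
  constructor <;> intro h <;> linarith

section ComputableRat

variable {α β : Type*} [Primcodable α] [Primcodable β]

theorem computableRat_ratOfCode {c : α → ℕ} (hc : Computable c) :
    ComputableRat fun a => ratOfCode (c a) :=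
  ⟨c, hc, fun _ => rfl⟩

theorem computableRat_const (q : ℚ) : ComputableRat fun _ : α => q :=
  let ⟨c, hc⟩ := ratOfCode_surjective q
  ⟨fun _ => c, Computable.const c, fun _ => hc⟩

theorem computableRat_natCast {f : α → ℕ} (hf : Computable f) :
    ComputableRat fun a => (f a : ℚ) :=
  ⟨fun a => Nat.pair (f a) (Nat.pair 0 0), computable_pair hf (Computable.const _),
    fun a => by rw [ratOfCode_pair]; simp⟩

theorem computableRat_natCast_div_two_pow {f s : α → ℕ} (hf : Computable f) (hs : Computable s) :
    ComputableRat fun a => (f a : ℚ) / 2 ^ s a := by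
  refine ⟨_, computable_pair hf (computable_pair (Computable.const 0)
    (Computable.pred.comp (computable_two_pow hs))), fun a => ?_⟩
  have hpos : 0 < 2 ^ s a := by positivity
  rw [ratOfCode_pair_pred _ _ hpos, Nat.cast_zero, sub_zero, Nat.cast_pow, Nat.cast_ofNat]

namespace ComputableRat

variable {p q : α → ℚ}

theorem comp (hq : ComputableRat q) {f : β → α} (hf : Computable f) :
    ComputableRat fun b => q (f b) :=
  let ⟨c, hc, hcq⟩ := hq
  ⟨fun b => c (f b), hc.comp hf, fun b => hcq (f b)⟩

theorem add (hp : ComputableRat p) (hq : ComputableRat q) : ComputableRat fun a => p a + q a := by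
  obtain ⟨c, hc, hcp⟩ := hp
  obtain ⟨d, hd, hdq⟩ := hq
  refine ⟨_, computable_pair
    (computable_add (computable_mul (computable_unpair_fst hc) (computable_code_den hd))
      (computable_mul (computable_unpair_fst hd) (computable_code_den hc)))
    (computable_pair
      (computable_add (computable_mul (computable_code_neg hc) (computable_code_den hd))
        (computable_mul (computable_code_neg hd) (computable_code_den hc)))
      (Computable.pred.comp (computable_mul (computable_code_den hc) (computable_code_den hd)))),
    fun a => ?_⟩
  beta_reduce
  rw [← hcp, ← hdq, ratOfCode_pair_pred _ _ (by positivity), ratOfCode, ratOfCode]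
  push_cast
  field_simp
  ring

theorem neg (hq : ComputableRat q) : ComputableRat fun a => -q a := by
  obtain ⟨c, hc, hcq⟩ := hq
  refine ⟨_, computable_pair (computable_code_neg hc) (computable_pair
    (computable_unpair_fst hc) (computable_unpair_snd (computable_unpair_snd hc))), fun a => ?_⟩
  beta_reduce
  rw [ratOfCode_pair, ← hcq, ratOfCode]
  ring

theorem sub (hp : ComputableRat p) (hq : ComputableRat q) : ComputableRat fun a => p a - q a := by
  simpa only [sub_eq_add_neg] using hp.add hq.neg

theorem ite {P : α → Prop} [DecidablePred P] (hP : ComputablePred P) (hp : ComputableRat p)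
    (hq : ComputableRat q) : ComputableRat fun a => if P a then p a else q a := by
  obtain ⟨c, hc, hcp⟩ := hp
  obtain ⟨d, hd, hdq⟩ := hq
  exact ⟨_, computable_ite hP hc hd, fun a => by rw [apply_ite ratOfCode, hcp, hdq]⟩

theorem computablePred_le (hp : ComputableRat p) (hq : ComputableRat q) :
    ComputablePred fun a => p a ≤ q a := by
  obtain ⟨c, hc, hcp⟩ := hp
  obtain ⟨d, hd, hdq⟩ := hq
  refine (SolovayVariants.computablePred_le
    (computable_add (computable_mul (computable_unpair_fst hc) (computable_code_den hd))
      (computable_mul (computable_code_neg hd) (computable_code_den hc)))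
    (computable_add (computable_mul (computable_unpair_fst hd) (computable_code_den hc))
      (computable_mul (computable_code_neg hc) (computable_code_den hd)))).of_eq fun a => ?_
  rw [← hcp, ← hdq, ratOfCode_le_iff]

theorem computablePred_lt (hp : ComputableRat p) (hq : ComputableRat q) :
    ComputablePred fun a => p a < q a :=
  (hq.computablePred_le hp).not.of_eq fun _ => not_le

theorem max (hp : ComputableRat p) (hq : ComputableRat q) :
    ComputableRat fun a => max (p a) (q a) := by
  simpa only [max_def] using ite (hp.computablePred_le hq) hq hp

theorem min (hp : ComputableRat p) (hq : ComputableRat q) :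
    ComputableRat fun a => min (p a) (q a) := by
  simpa only [min_def] using ite (hp.computablePred_le hq) hp hq

theorem sum_range {f : α → ℕ} {q : α → ℕ → ℚ} (hf : Computable f)
    (hq : ComputableRat fun x : α × ℕ => q x.1 x.2) :
    ComputableRat fun a => ∑ k ∈ Finset.range (f a), q a k := by
  have hadd : ComputableRat fun x : ℕ × ℕ => ratOfCode x.1 + ratOfCode x.2 :=
    (computableRat_ratOfCode Computable.fst).add (computableRat_ratOfCode Computable.snd)
  obtain ⟨plus, hplus, hplus_eq⟩ := hadd
  obtain ⟨zeroCode, hzeroCode⟩ := ratOfCode_surjective 0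
  obtain ⟨c, hc, hcq⟩ := hq
  have hstep : Computable₂ fun (a : α) (x : ℕ × ℕ) => plus (x.2, c (a, x.1)) :=
    hplus.comp ((Computable.snd.comp Computable.snd).pair
      (hc.comp (Computable.fst.pair (Computable.fst.comp Computable.snd))))
  refine ⟨_, Computable.nat_rec hf (Computable.const zeroCode) hstep, fun a => ?_⟩
  beta_reduce
  induction f a with
  | zero => exact hzeroCode
  | succ k ih =>
    rw [Finset.sum_range_succ, ← ih]
    exact (hplus_eq _).trans (congrArg _ (hcq (a, k)))

end ComputableRat

end ComputableRat

/-! ### Oracle machines run on computable oracles -/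

section OracleMachines

variable {α : Type*} [Primcodable α]

theorem OracleCode.partrec_eval (M : OracleCode) {O : α → ℕ → ℕ} (hO : Computable₂ O) :
    Partrec fun x : α × ℕ => M.eval (O x.1) x.2 := by
  induction M with
  | zero => exact (Computable.const 0).partrec
  | succ => exact (Computable.succ.comp Computable.snd).partrec
  | left => exact (computable_unpair_fst Computable.snd).partrec
  | right => exact (computable_unpair_snd Computable.snd).partrec
  | oracle => exact (hO.comp Computable.fst Computable.snd).partrec
  | pair c d hc hd =>
    refine (hc.bind ((hd.comp Computable.fst).map (computable_pair
      (Computable.snd.comp Computable.fst) Computable.snd).to₂).to₂).of_eq fun x => ?_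
    simp only [OracleCode.eval, Part.map_eq_map, Seq.seq, Part.bind_map]
  | comp c d hc hd =>
    exact hd.bind (hc.comp ((Computable.fst.comp Computable.fst).pair Computable.snd)).to₂
  | prec c d hc hd =>
    exact Partrec.nat_rec (computable_unpair_snd Computable.snd)
      (hc.comp (Computable.fst.pair (computable_unpair_fst Computable.snd)))
      (h := fun x p => d.eval (O x.1) (Nat.pair x.2.unpair.1 (Nat.pair p.1 p.2)))
      (hd.comp ((Computable.fst.comp Computable.fst).pair (computable_pair
        (computable_unpair_fst (Computable.snd.comp Computable.fst))
        (computable_pair (Computable.fst.comp Computable.snd)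
          (Computable.snd.comp Computable.snd))))).to₂
  | rfind c hc =>
    have heq : Computable fun m : ℕ => decide (m = 0) :=
      (Primrec.eq.decide.comp Primrec.id (Primrec.const 0)).to_comp
    exact Partrec.rfind (p := fun (x : α × ℕ) n =>
      (c.eval (O x.1) (Nat.pair x.2 n)).map fun m => decide (m = 0))
      ((hc.comp ((Computable.fst.comp Computable.fst).pair (computable_pair
        (Computable.snd.comp Computable.fst) Computable.snd))).map (heq.comp Computable.snd).to₂)

theorem IsEffectiveApprox.abs_sub_le {q : ℕ → ℚ} {x : ℝ} (h : IsEffectiveApprox q x) (n : ℕ) :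
    |(q n : ℝ) - x| ≤ 2 / 2 ^ n := by
  have hstep (k : ℕ) : dist (q k : ℝ) (q (k + 1)) ≤ 2 / 2 / 2 ^ k := by
    rw [Real.dist_eq, div_self two_ne_zero, one_div, ← inv_pow]
    have hle := (Rat.cast_le (K := ℝ)).2 (h.1 k).le
    push_cast at hle
    exact hle
  exact dist_le_of_le_geometric_two_of_tendsto hstep h.2 n

theorem isEffectiveApprox_const (q : ℚ) : IsEffectiveApprox (fun _ => q) q :=
  ⟨fun n => by rw [sub_self, abs_zero]; positivity, tendsto_const_nhds⟩

theorem ComputableRealOn.exists_partrec_approx {f : ℝ → ℝ} {X : Set ℝ}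
    (hf : ComputableRealOn f X) {p : α → ℚ} (hp : ComputableRat p) {k : α → ℕ}
    (hk : Computable k) :
    ∃ g : α →. ℕ, Partrec g ∧
      ∀ a, (p a : ℝ) ∈ X → ∃ v ∈ g a, |(ratOfCode v : ℝ) - f (p a)| ≤ 2 / 2 ^ k a := by
  obtain ⟨M, hM⟩ := hf
  obtain ⟨c, hc, hcp⟩ := hp
  refine ⟨fun a => M.eval (fun _ => c a) (k a),
    (M.partrec_eval (hc.comp Computable.fst).to₂).comp (Computable.id.pair hk), fun a ha => ?_⟩
  have hconst : IsEffectiveApprox (fun _ => ratOfCode (c a)) (p a) := by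
    rw [hcp]
    exact isEffectiveApprox_const (p a)
  obtain ⟨q, hq, hqf⟩ := hM (p a) ha (fun _ => c a) hconst
  exact ⟨q (k a), hq (k a), hqf.abs_sub_le (k a)⟩

end OracleMachines

/-! ### Dyadic cells -/

/-- The left endpoint of the `j`-th dyadic cell of level `s`. -/
def cellLeft (s j : ℕ) : ℚ := j / 2 ^ s - s

/-- The `j`-th dyadic cell of level `s`. The cells of level `s` partition the half-line `(-s, ∞)`
into intervals of length `1 / 2 ^ s`; the shift by `s` lets the index be a natural number while
every real is in a cell of each sufficiently large level. -/
def cell (s j : ℕ) : Set ℝ := Set.Ioc (cellLeft s j : ℝ) (cellLeft s j + 1 / 2 ^ s)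

section Cell

variable {s t i j : ℕ} {x : ℝ}

theorem cast_cellLeft (s j : ℕ) : (cellLeft s j : ℝ) = j / 2 ^ s - s := by
  simp only [cellLeft, Rat.cast_sub, Rat.cast_div, Rat.cast_natCast, Rat.cast_pow, Rat.cast_ofNat]

theorem mem_cell_iff : x ∈ cell s j ↔ (j : ℝ) < (x + s) * 2 ^ s ∧ (x + s) * 2 ^ s ≤ j + 1 := by
  rw [cell, Set.mem_Ioc, cast_cellLeft, sub_lt_iff_lt_add, div_lt_iff₀ (by positivity),
    sub_add_eq_add_sub, le_sub_iff_add_le, ← add_div, le_div_iff₀ (by positivity)]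

theorem exists_mem_cell (hx : -(s : ℝ) < x) : ∃ j, x ∈ cell s j := by
  have hpos : 0 < (x + s) * 2 ^ s := mul_pos (by linarith) (by positivity)
  obtain ⟨j, hj⟩ := Nat.exists_eq_add_one.2 (Nat.ceil_pos.2 hpos)
  refine ⟨j, mem_cell_iff.2 ⟨Nat.lt_ceil.1 (by omega), ?_⟩⟩
  exact_mod_cast hj ▸ Nat.le_ceil ((x + s) * 2 ^ s)

theorem measurableSet_cell (s j : ℕ) : MeasurableSet (cell s j) :=
  measurableSet_Ioc

theorem volume_real_cell (s j : ℕ) : volume.real (cell s j) = 1 / 2 ^ s := by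
  rw [cell, Real.volume_real_Ioc_of_le (by simp), add_sub_cancel_left]

theorem volume_cell_ne_top (s j : ℕ) : volume (cell s j) ≠ ⊤ :=
  measure_Ioc_lt_top.ne

theorem dist_lt_of_mem_cell {y : ℝ} (hx : x ∈ cell s j) (hy : y ∈ cell s j) :
    dist x y < 1 / 2 ^ s := by
  rw [Real.dist_eq, abs_lt]
  exact ⟨by linarith [hx.1, hy.2], by linarith [hx.2, hy.1]⟩

theorem cell_subset_Ioo_iff {a b : ℝ} :
    cell s j ⊆ Set.Ioo a b ↔ a ≤ cellLeft s j ∧ (cellLeft s j : ℝ) + 1 / 2 ^ s < b := by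
  have hlt : (cellLeft s j : ℝ) < cellLeft s j + 1 / 2 ^ s := lt_add_of_pos_right _ (by positivity)
  exact ⟨fun h => ⟨((Set.Ioc_subset_Ioc_iff hlt).1 (h.trans Set.Ioo_subset_Ioc_self)).2,
    (h ⟨hlt, le_rfl⟩).2⟩, fun h => Set.Ioc_subset_Ioo h.1 h.2⟩

theorem cell_subset_cell_iff : cell s j ⊆ cell t i ↔
    cellLeft s j + 1 / 2 ^ s ≤ cellLeft t i + 1 / 2 ^ t ∧ cellLeft t i ≤ cellLeft s j := by
  rw [cell, cell, Set.Ioc_subset_Ioc_iff (lt_add_of_pos_right _ (by positivity)),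
    ← Rat.cast_le (K := ℝ), ← Rat.cast_le (K := ℝ)]
  push_cast
  rfl

theorem cell_index_unique (hi : x ∈ cell s i) (hj : x ∈ cell s j) : i = j := by
  rw [mem_cell_iff] at hi hj
  have hij : (i : ℝ) < j + 1 := hi.1.trans_le hj.2
  have hji : (j : ℝ) < i + 1 := hj.1.trans_le hi.2
  exact le_antisymm (Nat.lt_succ_iff.1 (mod_cast hij)) (Nat.lt_succ_iff.1 (mod_cast hji))

theorem cell_subset_cell (hts : t ≤ s) (hi : x ∈ cell t i) (hj : x ∈ cell s j) :
    cell s j ⊆ cell t i := by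
  obtain ⟨d, rfl⟩ := Nat.exists_eq_add_of_le hts
  have hscale (y : ℝ) : (y + t) * 2 ^ t * 2 ^ d + d * 2 ^ (t + d) =
      (y + (t + d : ℕ)) * 2 ^ (t + d) := by
    push_cast
    ring
  simp only [mem_cell_iff, Set.subset_def, ← hscale] at hi hj ⊢
  have hd : (0 : ℝ) < 2 ^ d := by positivity
  have hleft : i * 2 ^ d + d * 2 ^ (t + d) < j + 1 := by
    rw [← Nat.cast_lt (α := ℝ)]
    push_cast
    nlinarith
  have hright : j < (i + 1) * 2 ^ d + d * 2 ^ (t + d) := by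
    rw [← Nat.cast_lt (α := ℝ)]
    push_cast
    nlinarith
  have hleft' : (i : ℝ) * 2 ^ d + d * 2 ^ (t + d) ≤ j := mod_cast Nat.lt_succ_iff.1 hleft
  have hright' : (j : ℝ) + 1 ≤ (i + 1) * 2 ^ d + d * 2 ^ (t + d) := mod_cast hright
  exact fun y hy => ⟨lt_of_mul_lt_mul_right (by linarith) hd.le,
    le_of_mul_le_mul_right (by linarith) hd⟩

theorem index_le_of_cellLeft_le (hts : t ≤ s) (h : cellLeft t i ≤ cellLeft s j) : i ≤ j := by
  have hpow : (2 : ℚ) ^ t ≤ 2 ^ s := pow_le_pow_right₀ one_le_two hts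
  have hcast : (t : ℚ) ≤ s := mod_cast hts
  have hdiv : (i : ℚ) / 2 ^ t ≤ j / 2 ^ t := calc
    (i : ℚ) / 2 ^ t ≤ j / 2 ^ s := by simp only [cellLeft] at h; linarith
    _ ≤ j / 2 ^ t := by gcongr
  exact_mod_cast (div_le_div_iff_of_pos_right (by positivity)).1 hdiv

end Cell

/-- The cell `cell s j` is contained in one of the sets `I 0, …, I (N - 1)`. -/
def CellCovered (I : ℕ → Set ℝ) (N s j : ℕ) : Prop :=
  ∃ k < N, cell s j ⊆ I k

/-- The cell `cell s j` is covered by level `s` (by one of `I 0, …, I (s - 1)`), but is not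
contained in a cell of a smaller level `t` that is covered by level `t`. The maximal cells
decompose `⋃ k, I k`, for open sets `I k`, in a way that can be computed from the sequence. -/
def CellMaximal (I : ℕ → Set ℝ) (s j : ℕ) : Prop :=
  CellCovered I s s j ∧ ∀ t < s, ∀ i, CellCovered I t t i → ¬ cell s j ⊆ cell t i

/-- The cell whose level and index are paired in `e` if it is maximal, and `∅` otherwise. -/
def maximalCell (I : ℕ → Set ℝ) (e : ℕ) : Set ℝ :=
  {x | CellMaximal I e.unpair.1 e.unpair.2 ∧ x ∈ cell e.unpair.1 e.unpair.2}

open Classical in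
/-- The length of `maximalCell I e`. -/
noncomputable def maximalLength (I : ℕ → Set ℝ) (e : ℕ) : ℚ :=
  if CellMaximal I e.unpair.1 e.unpair.2 then 1 / 2 ^ e.unpair.1 else 0

section MaximalCell

variable {I : ℕ → Set ℝ} {s t i j : ℕ} {x : ℝ}

theorem CellMaximal.le_level (hs : CellMaximal I s i) (ht : CellMaximal I t j)
    (hi : x ∈ cell s i) (hj : x ∈ cell t j) : s ≤ t :=
  not_lt.1 fun hts => hs.2 t hts j ht.1 (cell_subset_cell hts.le hj hi)

theorem pairwise_disjoint_maximalCell (I : ℕ → Set ℝ) :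
    Pairwise (Function.onFun Disjoint (maximalCell I)) := by
  refine fun d e hde => Set.disjoint_left.2 fun x ⟨hd, hxd⟩ ⟨he, hxe⟩ => hde ?_
  have hlevel : d.unpair.1 = e.unpair.1 :=
    le_antisymm (hd.le_level he hxd hxe) (he.le_level hd hxe hxd)
  rw [hlevel] at hxd
  rw [← Nat.pair_unpair d, ← Nat.pair_unpair e, hlevel, cell_index_unique hxd hxe]

theorem maximalCell_of_maximal {e : ℕ} (h : CellMaximal I e.unpair.1 e.unpair.2) :
    maximalCell I e = cell e.unpair.1 e.unpair.2 :=
  Set.ext fun _ => and_iff_right h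

theorem maximalCell_of_not_maximal {e : ℕ} (h : ¬ CellMaximal I e.unpair.1 e.unpair.2) :
    maximalCell I e = ∅ :=
  Set.eq_empty_of_forall_notMem fun _ hx => h hx.1

theorem measurableSet_maximalCell (I : ℕ → Set ℝ) (e : ℕ) : MeasurableSet (maximalCell I e) :=
  (MeasurableSet.const _).inter (measurableSet_cell _ _)

theorem volume_real_maximalCell (I : ℕ → Set ℝ) (e : ℕ) :
    volume.real (maximalCell I e) = maximalLength I e := by
  rw [maximalLength]
  split_ifs with h
  · rw [maximalCell_of_maximal h, volume_real_cell]
    push_cast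
    rfl
  · rw [maximalCell_of_not_maximal h, measureReal_empty, Rat.cast_zero]

theorem eventually_one_div_two_pow_lt {ε : ℝ} (hε : 0 < ε) :
    ∀ᶠ s : ℕ in atTop, 1 / 2 ^ s < ε := by
  simpa only [one_div_pow] using (tendsto_pow_atTop_nhds_zero_of_lt_one (r := (1 / 2 : ℝ))
    (by norm_num) (by norm_num)).eventually_lt_const hε

theorem exists_cellMaximal (hI : ∀ k, IsOpen (I k)) (hx : x ∈ ⋃ k, I k) :
    ∃ s j, CellMaximal I s j ∧ x ∈ cell s j := by
  classical
  have hcovered : ∃ s j, CellCovered I s s j ∧ x ∈ cell s j := by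
    obtain ⟨k, hk⟩ := Set.mem_iUnion.1 hx
    obtain ⟨ε, hε, hball⟩ := Metric.isOpen_iff.1 (hI k) x hk
    obtain ⟨s, hsε, hks, hsx⟩ := ((eventually_one_div_two_pow_lt hε).and
      ((eventually_gt_atTop k).and (tendsto_natCast_atTop_atTop.eventually_gt_atTop (-x)))).exists
    obtain ⟨j, hj⟩ := exists_mem_cell (neg_lt.1 hsx)
    exact ⟨s, j, ⟨k, hks, fun y hy => hball ((dist_lt_of_mem_cell hy hj).trans hsε)⟩, hj⟩
  obtain ⟨j, hj, hxj⟩ := Nat.find_spec hcovered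
  exact ⟨_, j, ⟨hj, fun t ht i hi hsub => Nat.find_min hcovered ht ⟨i, hi, hsub hxj⟩⟩, hxj⟩

theorem iUnion_maximalCell (hI : ∀ k, IsOpen (I k)) : ⋃ e, maximalCell I e = ⋃ k, I k := by
  refine Set.Subset.antisymm (Set.iUnion_subset fun e x hx => ?_) fun x hx => ?_
  · obtain ⟨k, -, hk⟩ := hx.1.1
    exact Set.mem_iUnion.2 ⟨k, hk hx.2⟩
  · obtain ⟨s, j, hmax, hxj⟩ := exists_cellMaximal hI hx
    refine Set.mem_iUnion.2 ⟨Nat.pair s j, ?_⟩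
    rw [maximalCell, Nat.unpair_pair]
    exact ⟨hmax, hxj⟩

end MaximalCell

/-! ### Computable families of intervals -/

/-- A family of open intervals with computable rational endpoints (`Set.Ioo` makes the interval
empty when the left endpoint is not below the right one). -/
def ComputableIntervals {α : Type*} [Primcodable α] (I : α → Set ℝ) : Prop :=
  ∃ l r : α → ℚ, ComputableRat l ∧ ComputableRat r ∧ ∀ a, I a = Set.Ioo (l a : ℝ) (r a)

theorem uniformlyCEOpen_iff {U : ℕ → Set ℝ} : UniformlyCEOpen U ↔
    ∃ I : ℕ → ℕ → Set ℝ, ComputableIntervals (fun x : ℕ × ℕ => I x.1 x.2) ∧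
      ∀ n, U n = ⋃ k, I n k := by
  constructor
  · rintro ⟨l, r, hl, hr, hU⟩
    exact ⟨_, ⟨_, _, computableRat_ratOfCode hl, computableRat_ratOfCode hr, fun _ => rfl⟩, hU⟩
  · rintro ⟨I, ⟨l, r, ⟨c, hc, hcl⟩, ⟨d, hd, hdr⟩, hI⟩, hU⟩
    refine ⟨fun n k => c (n, k), fun n k => d (n, k), hc.to₂, hd.to₂, fun n => ?_⟩
    simp only [hcl, hdr, hU, ← hI]

section ComputableCells

variable {α : Type*} [Primcodable α] {I : α → ℕ → Set ℝ} {N s j : α → ℕ}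

theorem ComputableIntervals.isOpen {I : α → Set ℝ} (hI : ComputableIntervals I) (a : α) :
    IsOpen (I a) := by
  obtain ⟨l, r, -, -, hIoo⟩ := hI
  exact hIoo a ▸ isOpen_Ioo

theorem computableRat_cellLeft (hs : Computable s) (hj : Computable j) :
    ComputableRat fun a => cellLeft (s a) (j a) :=
  (computableRat_natCast_div_two_pow hj hs).sub (computableRat_natCast hs)

theorem computableRat_one_div_two_pow (hs : Computable s) :
    ComputableRat fun a => 1 / 2 ^ s a := by
  simpa only [Nat.cast_one] using computableRat_natCast_div_two_pow (Computable.const 1) hs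

theorem computablePred_cellCovered (hI : ComputableIntervals fun x : α × ℕ => I x.1 x.2)
    (hN : Computable N) (hs : Computable s) (hj : Computable j) :
    ComputablePred fun a => CellCovered (I a) (N a) (s a) (j a) := by
  obtain ⟨l, r, hl, hr, hIoo⟩ := hI
  have hs' := hs.comp (Computable.fst (β := ℕ))
  have hleft := computableRat_cellLeft hs' (hj.comp Computable.fst)
  refine (computablePred_exists_lt hN (p := fun a k => l (a, k) ≤ cellLeft (s a) (j a) ∧
    cellLeft (s a) (j a) + 1 / 2 ^ s a < r (a, k)) (computablePred_and (hl.computablePred_le hleft)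
      ((hleft.add (computableRat_one_div_two_pow hs')).computablePred_lt hr))).of_eq fun a => ?_
  refine exists_congr fun k => and_congr_right fun _ => ?_
  have hIk : I a k = Set.Ioo (l (a, k) : ℝ) (r (a, k)) := hIoo (a, k)
  rw [hIk, cell_subset_Ioo_iff, ← Rat.cast_le (K := ℝ), ← Rat.cast_lt (K := ℝ)]
  push_cast
  rfl

theorem cellMaximal_iff {I : ℕ → Set ℝ} {s j : ℕ} : CellMaximal I s j ↔ CellCovered I s s j ∧
    ¬ ∃ t < s, ∃ i < j + 1, CellCovered I t t i ∧ cell s j ⊆ cell t i := by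
  simp only [CellMaximal, not_exists, not_and]
  exact and_congr_right fun _ => forall₂_congr fun t ht => forall_congr' fun i =>
    ⟨fun h _ => h, fun h hi hsub => h (Nat.lt_succ_of_le
      (index_le_of_cellLeft_le ht.le (cell_subset_cell_iff.1 hsub).2)) hi hsub⟩

theorem computablePred_cell_subset_cell {t i : α → ℕ} (hs : Computable s) (hj : Computable j)
    (ht : Computable t) (hi : Computable i) :
    ComputablePred fun a => cell (s a) (j a) ⊆ cell (t a) (i a) := by
  have hleft := computableRat_cellLeft hs hj
  have hleft' := computableRat_cellLeft ht hi
  exact (computablePred_and ((hleft.add (computableRat_one_div_two_pow hs)).computablePred_le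
    (hleft'.add (computableRat_one_div_two_pow ht))) (hleft'.computablePred_le hleft)).of_eq
      fun _ => cell_subset_cell_iff.symm

theorem ComputableIntervals.comp {β : Type*} [Primcodable β] {I : α → Set ℝ}
    (hI : ComputableIntervals I) {f : β → α} (hf : Computable f) :
    ComputableIntervals fun b => I (f b) := by
  obtain ⟨l, r, hl, hr, hIoo⟩ := hI
  exact ⟨_, _, hl.comp hf, hr.comp hf, fun b => hIoo (f b)⟩

theorem computablePred_cellMaximal (hI : ComputableIntervals fun x : α × ℕ => I x.1 x.2)
    (hs : Computable s) (hj : Computable j) :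
    ComputablePred fun a => CellMaximal (I a) (s a) (j a) := by
  have ha : Computable fun x : (α × ℕ) × ℕ => x.1.1 := Computable.fst.comp Computable.fst
  have ht : Computable fun x : (α × ℕ) × ℕ => x.1.2 := Computable.snd.comp Computable.fst
  refine (computablePred_and (computablePred_cellCovered hI hs hs hj)
    (computablePred_exists_lt hs (computablePred_exists_lt
      (p := fun x i => CellCovered (I x.1) x.2 x.2 i ∧ cell (s x.1) (j x.1) ⊆ cell x.2 i)
      (Computable.succ.comp (hj.comp Computable.fst)) (computablePred_and
        (computablePred_cellCovered (hI.comp ((ha.comp Computable.fst).pair Computable.snd))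
          ht ht Computable.snd)
        (computablePred_cell_subset_cell (hs.comp ha) (hj.comp ha) ht Computable.snd)))).not).of_eq
    fun _ => cellMaximal_iff.symm

theorem computableRat_maximalLength (hI : ComputableIntervals fun x : α × ℕ => I x.1 x.2)
    {e : α → ℕ} (he : Computable e) : ComputableRat fun a => maximalLength (I a) (e a) := by
  classical
  exact ComputableRat.ite (computablePred_cellMaximal hI (computable_unpair_fst he)
    (computable_unpair_snd he)) (computableRat_one_div_two_pow (computable_unpair_fst he))
      (computableRat_const 0)

end ComputableCells

/-! ### Measures of countable unions -/

theorem iUnion_eq_biUnion_range_union {Ω : Type*} (A : ℕ → Set Ω) (N : ℕ) :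
    ⋃ e, A e = (⋃ e ∈ Finset.range N, A e) ∪ ⋃ e, A (e + N) := by
  refine Set.Subset.antisymm (Set.iUnion_subset fun e => ?_) (Set.union_subset
    (Set.iUnion₂_subset fun e _ => Set.subset_iUnion A e)
    (Set.iUnion_subset fun e => Set.subset_iUnion A (e + N)))
  rcases lt_or_ge e N with he | he
  · exact (Set.subset_biUnion_of_mem (u := A) (Finset.mem_range.2 he)).trans
      Set.subset_union_left
  · exact (Nat.sub_add_cancel he ▸ Set.subset_iUnion (fun d => A (d + N)) (e - N)).trans
      Set.subset_union_right

section Measure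

variable {Ω : Type*} [MeasurableSpace Ω] {μ : Measure Ω}

theorem measure_iUnion_le_mul {ι : Type*} [Countable ι] {A W : ι → Set Ω} {C : ℝ≥0∞}
    (hA : ∀ i, MeasurableSet (A i)) (hdisj : Pairwise (Function.onFun Disjoint A))
    (hW : ∀ i, μ (W i) ≤ C * μ (A i)) : μ (⋃ i, W i) ≤ C * μ (⋃ i, A i) :=
  calc μ (⋃ i, W i) ≤ ∑' i, μ (W i) := measure_iUnion_le W
    _ ≤ ∑' i, C * μ (A i) := ENNReal.tsum_le_tsum hW
    _ = C * μ (⋃ i, A i) := by rw [ENNReal.tsum_mul_left, measure_iUnion hdisj hA]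

theorem hasSum_measureReal_iUnion {A : ℕ → Set Ω} (hA : ∀ e, MeasurableSet (A e))
    (hdisj : Pairwise (Function.onFun Disjoint A)) (hfin : μ (⋃ e, A e) ≠ ⊤) :
    HasSum (fun e => μ.real (A e)) (μ.real (⋃ e, A e)) := by
  have hfin' (e : ℕ) : μ (A e) ≠ ⊤ := measure_ne_top_of_subset (Set.subset_iUnion A e) hfin
  rw [measure_iUnion hdisj hA] at hfin
  rw [Measure.real, measure_iUnion hdisj hA, ENNReal.tsum_toReal_eq hfin']
  exact ENNReal.hasSum_toReal hfin

theorem measureReal_iUnion_sub_le {A W : ℕ → Set Ω} {C : ℝ≥0} (hA : ∀ e, MeasurableSet (A e))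
    (hdisj : Pairwise (Function.onFun Disjoint A)) (hfin : μ (⋃ e, A e) ≠ ⊤)
    (hW : ∀ e, μ (W e) ≤ C * μ (A e)) (N : ℕ) :
    μ.real (⋃ e, W e) - μ.real (⋃ e ∈ Finset.range N, W e) ≤
      C * (μ.real (⋃ e, A e) - ∑ e ∈ Finset.range N, μ.real (A e)) := by
  have htail_ne_top : μ (⋃ e, A (e + N)) ≠ ⊤ :=
    measure_ne_top_of_subset (Set.iUnion_subset fun e => Set.subset_iUnion A _) hfin
  have hdisj_tail : Pairwise (Function.onFun Disjoint fun e => A (e + N)) :=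
    hdisj.comp_of_injective (add_left_injective N)
  have hW_tail : μ.real (⋃ e, W (e + N)) ≤ C * μ.real (⋃ e, A (e + N)) := by
    refine (ENNReal.toReal_mono (ENNReal.mul_ne_top ENNReal.coe_ne_top htail_ne_top)
      (measure_iUnion_le_mul (fun e => hA (e + N)) hdisj_tail fun e => hW (e + N))).trans_eq ?_
    rw [ENNReal.toReal_mul, ENNReal.coe_toReal, Measure.real]
  have hA_tail : μ.real (⋃ e, A (e + N)) =
      μ.real (⋃ e, A e) - ∑ e ∈ Finset.range N, μ.real (A e) :=
    (hasSum_measureReal_iUnion (fun e => hA (e + N)) hdisj_tail htail_ne_top).unique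
      ((hasSum_nat_add_iff' N).2 (hasSum_measureReal_iUnion hA hdisj hfin))
  rw [← hA_tail, iUnion_eq_biUnion_range_union W N]
  linarith [measureReal_union_le (μ := μ) (⋃ e ∈ Finset.range N, W e) (⋃ e, W (e + N))]

end Measure

theorem natCast_mul_le_pow_of_two_mul_eq_one {R : Type*} [CommSemiring R] [PartialOrder R]
    [IsOrderedRing R] {a h : R} {C n : ℕ} (h0 : 0 ≤ h) (h2 : 2 * h = 1) (ha : a ≤ h ^ (n + C)) :
    C * a ≤ h ^ n := by
  have hC : (C : R) ≤ 2 ^ C := by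
    simpa only [Nat.cast_pow, Nat.cast_ofNat] using
      Nat.mono_cast (α := R) (Nat.lt_two_pow_self (n := C)).le
  calc C * a ≤ C * h ^ (n + C) := mul_le_mul_of_nonneg_left ha C.cast_nonneg
    _ ≤ 2 ^ C * h ^ (n + C) := mul_le_mul_of_nonneg_right hC (pow_nonneg h0 _)
    _ = h ^ n * (2 * h) ^ C := by ring
    _ = h ^ n := by rw [h2, one_pow, mul_one]

open Classical in
/-- The indices of the cells of level `s` in `(-s, s]` that are covered by one of the sets
`I 0, …, I (N - 1)`. -/
noncomputable def coveredCells (I : ℕ → Set ℝ) (N s : ℕ) : Finset ℕ :=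
  {j ∈ Finset.range (2 * s * 2 ^ s) | CellCovered I N s j}

section CoveredCells

variable {N s : ℕ}

theorem mem_coveredCells {I : ℕ → Set ℝ} {j : ℕ} :
    j ∈ coveredCells I N s ↔ j < 2 * s * 2 ^ s ∧ CellCovered I N s j := by
  simp only [coveredCells, Finset.mem_filter, Finset.mem_range]

theorem volume_real_biUnion_cell (F : Finset ℕ) :
    volume.real (⋃ j ∈ F, cell s j) = F.card / 2 ^ s := by
  rw [measureReal_biUnion_finset (fun i _ j _ hij => Set.disjoint_left.2
    fun x hi hj => hij (cell_index_unique hi hj)) (fun j _ => measurableSet_cell s j)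
    fun j _ => volume_cell_ne_top s j]
  simp only [volume_real_cell, Finset.sum_const, nsmul_eq_mul, mul_one_div]

theorem biUnion_coveredCells_subset (I : ℕ → Set ℝ) (N s : ℕ) :
    ⋃ j ∈ coveredCells I N s, cell s j ⊆ ⋃ k ∈ Finset.range N, I k := by
  refine Set.iUnion₂_subset fun j hj => ?_
  obtain ⟨k, hk, hsub⟩ := (mem_coveredCells.1 hj).2
  exact hsub.trans (Set.subset_biUnion_of_mem (u := I) (Finset.mem_range.2 hk))

/-- A point of an interval whose cell is not contained in the interval is within the length of the
cell of an endpoint. -/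
theorem biUnion_Ioo_subset {l r : ℕ → ℝ}
    (hI : ∀ k < N, Set.Ioo (l k) (r k) ⊆ Set.Ioc (-(s : ℝ)) s) :
    ⋃ k ∈ Finset.range N, Set.Ioo (l k) (r k) ⊆
      (⋃ j ∈ coveredCells (fun k => Set.Ioo (l k) (r k)) N s, cell s j) ∪
        ⋃ k ∈ Finset.range N,
          (Set.Ioc (l k) (l k + 1 / 2 ^ s) ∪ Set.Ico (r k - 1 / 2 ^ s) (r k)) := by
  refine Set.iUnion₂_subset fun k hk x hx => ?_
  obtain ⟨hsx, hxs⟩ := hI k (Finset.mem_range.1 hk) hx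
  obtain ⟨j, hj⟩ := exists_mem_cell hsx
  by_cases hsub : cell s j ⊆ Set.Ioo (l k) (r k)
  · refine Or.inl (Set.mem_biUnion (mem_coveredCells.2 ⟨?_, k, Finset.mem_range.1 hk, hsub⟩) hj)
    have hlt : (j : ℝ) < (s + s) * 2 ^ s := (mem_cell_iff.1 hj).1.trans_le (by gcongr)
    rw [two_mul]
    exact_mod_cast hlt
  · refine Or.inr (Set.mem_biUnion hk ?_)
    rw [cell_subset_Ioo_iff, not_and_or, not_le, not_lt] at hsub
    exact hsub.imp (fun h => ⟨hx.1, by linarith [hj.2]⟩) (fun h => ⟨by linarith [hj.1], hx.2⟩)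

theorem abs_volume_real_sub_card_coveredCells_le {l r : ℕ → ℝ}
    (hI : ∀ k < N, Set.Ioo (l k) (r k) ⊆ Set.Ioc (-(s : ℝ)) s) :
    |volume.real (⋃ k ∈ Finset.range N, Set.Ioo (l k) (r k)) -
      (coveredCells (fun k => Set.Ioo (l k) (r k)) N s).card / 2 ^ s| ≤ 2 * N / 2 ^ s := by
  have hfin : volume (⋃ k ∈ Finset.range N, Set.Ioo (l k) (r k)) ≠ ⊤ :=
    measure_ne_top_of_subset (Set.iUnion₂_subset fun k hk => hI k (Finset.mem_range.1 hk))
      measure_Ioc_lt_top.ne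
  set E : ℕ → Set ℝ := fun k => Set.Ioc (l k) (l k + 1 / 2 ^ s) ∪ Set.Ico (r k - 1 / 2 ^ s) (r k)
  have hE (k : ℕ) : volume.real (E k) ≤ 2 / 2 ^ s := by
    refine (measureReal_union_le _ _).trans_eq ?_
    rw [Real.volume_real_Ioc_of_le (by simp), Real.volume_real_Ico_of_le (by simp)]
    ring
  have hfin' : volume ((⋃ j ∈ coveredCells (fun k => Set.Ioo (l k) (r k)) N s, cell s j) ∪
      ⋃ k ∈ Finset.range N, E k) ≠ ⊤ :=
    (measure_union_lt_top
      (measure_biUnion_lt_top (Finset.finite_toSet _) fun _ _ => measure_Ioc_lt_top)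
      (measure_biUnion_lt_top (Finset.finite_toSet _) fun _ _ =>
        measure_union_lt_top measure_Ioc_lt_top measure_Ico_lt_top)).ne
  rw [← volume_real_biUnion_cell, abs_of_nonneg
    (sub_nonneg.2 (measureReal_mono (biUnion_coveredCells_subset _ N s) hfin)), sub_le_iff_le_add']
  calc
    _ ≤ _ := measureReal_mono (biUnion_Ioo_subset hI) hfin'
    _ ≤ _ := measureReal_union_le _ _
    _ ≤ _ := by
      gcongr
      refine (measureReal_biUnion_finset_le _ _).trans
        ((Finset.sum_le_sum fun k _ => hE k).trans_eq ?_)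
      rw [Finset.sum_const, Finset.card_range, nsmul_eq_mul, mul_comm, div_mul_eq_mul_div]

end CoveredCells

section UniformlyComputable

theorem ComputableRat.uniformlyComputable {x : ℕ → ℝ} {q : ℕ → ℕ → ℚ}
    (hq : ComputableRat fun y : ℕ × ℕ => q y.1 y.2)
    (hx : ∀ n i, |x n - (q n i : ℝ)| ≤ 2⁻¹ ^ i) : UniformlyComputable x := by
  obtain ⟨c, hc, hcq⟩ := hq
  refine ⟨fun n i => c (n, i), hc.to₂, fun n i => ?_⟩
  rw [hcq]
  exact hx n i

theorem UniformlyComputable.comp {x : ℕ → ℝ} (hx : UniformlyComputable x) {f : ℕ → ℕ}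
    (hf : Computable f) : UniformlyComputable fun n => x (f n) := by
  obtain ⟨a, ha, hax⟩ := hx
  exact ⟨fun n => a (f n), ha.comp (hf.comp Computable.fst) Computable.snd, fun n => hax (f n)⟩

theorem UniformlyComputable.exists_computable_modulus {x : ℕ → ℝ} (hx : UniformlyComputable x)
    {q : ℕ → ℕ → ℚ} (hq : ComputableRat fun y : ℕ × ℕ => q y.1 y.2)
    (hlim : ∀ n, Tendsto (fun N => (q n N : ℝ)) atTop (𝓝 (x n))) :
    ∃ N : ℕ → ℕ → ℕ, Computable₂ N ∧ ∀ n i, x n - q n (N n i) ≤ 2⁻¹ ^ i := by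
  classical
  obtain ⟨a, ha, hax⟩ := hx
  let Close (y : ℕ × ℕ) (N : ℕ) : Prop :=
    ratOfCode (a y.1 (y.2 + 2)) ≤ q y.1 N + 1 / 2 ^ (y.2 + 1)
  have close_iff (n i N : ℕ) : Close (n, i) N ↔
      (ratOfCode (a n (i + 2)) : ℝ) ≤ q n N + 2 * 2⁻¹ ^ (i + 2) := by
    have hpow : (1 / 2 ^ (i + 1) : ℝ) = 2 * 2⁻¹ ^ (i + 2) := by
      rw [one_div, ← inv_pow]
      ring
    simp only [Close]
    rw [← Rat.cast_le (K := ℝ)]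
    push_cast
    rw [hpow]
  have hfst : Computable fun z : (ℕ × ℕ) × ℕ => z.1.1 := Computable.fst.comp Computable.fst
  have hsnd : Computable fun z : (ℕ × ℕ) × ℕ => z.1.2 := Computable.snd.comp Computable.fst
  have hcomp : ComputablePred fun z : (ℕ × ℕ) × ℕ => Close z.1 z.2 :=
    (computableRat_ratOfCode (ha.comp hfst
      (computable_add hsnd (Computable.const 2)))).computablePred_le
      ((hq.comp (hfst.pair Computable.snd)).add
        (computableRat_one_div_two_pow (Computable.succ.comp hsnd)))
  have hex (y : ℕ × ℕ) : ∃ N, Close y N := by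
    obtain ⟨n, i⟩ := y
    obtain ⟨N, hN⟩ := ((hlim n).eventually_const_lt
      (sub_lt_self (x n) (by positivity : (0 : ℝ) < 2⁻¹ ^ (i + 2)))).exists
    exact ⟨N, (close_iff n i N).2 (by linarith [(abs_le.1 (hax n (i + 2))).1])⟩
  refine ⟨fun n i => Nat.find (hex (n, i)), Computable.find hcomp hex, fun n i => ?_⟩
  have hclose := (close_iff n i _).1 (Nat.find_spec (hex (n, i)))
  have hpow : (2⁻¹ : ℝ) ^ i = 4 * 2⁻¹ ^ (i + 2) := by ring
  have hpos : (0 : ℝ) < 2⁻¹ ^ (i + 2) := by positivity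
  linarith [(abs_le.1 (hax n (i + 2))).2]

theorem computable_card_coveredCells {α : Type*} [Primcodable α] {I : α → ℕ → Set ℝ}
    (hI : ComputableIntervals fun x : α × ℕ => I x.1 x.2) {N s : α → ℕ} (hN : Computable N)
    (hs : Computable s) : Computable fun a => (coveredCells (I a) (N a) (s a)).card :=
  computable_card_filter_range
    (computable_mul (computable_mul (Computable.const 2) hs) (computable_two_pow hs))
    (computablePred_cellCovered (hI.comp ((Computable.fst.comp Computable.fst).pair Computable.snd))
      (hN.comp Computable.fst) (hs.comp Computable.fst) Computable.snd)

theorem two_mul_div_two_pow_le {N i s : ℕ} (hs : N + i + 1 ≤ s) :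
    (2 * N / 2 ^ s : ℝ) ≤ 2⁻¹ ^ i := by
  rw [div_le_iff₀ (by positivity), inv_pow, inv_mul_eq_div, le_div_iff₀ (by positivity)]
  calc (2 * N * 2 ^ i : ℝ) ≤ 2 * 2 ^ N * 2 ^ i := by
        gcongr
        exact_mod_cast Nat.lt_two_pow_self.le
    _ = 2 ^ (N + i + 1) := by ring
    _ ≤ 2 ^ s := pow_le_pow_right₀ one_le_two hs

theorem uniformlyComputable_volume_iUnion {I : ℕ → ℕ → Set ℝ}
    (hI : ComputableIntervals fun x : ℕ × ℕ => I x.1 x.2) {D : ℕ}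
    (hD : ∀ n k, I n k ⊆ Set.Ioc (-(D : ℝ)) D) {N : ℕ → ℕ → ℕ} (hN : Computable₂ N)
    (hIN : ∀ n i, volume.real (⋃ k, I n k) - volume.real (⋃ k ∈ Finset.range (N n i), I n k) ≤
      2⁻¹ ^ i) :
    UniformlyComputable fun n => volume.real (⋃ k, I n k) := by
  let terms (y : ℕ × ℕ) : ℕ := N y.1 (y.2 + 1)
  let level (y : ℕ × ℕ) : ℕ := terms y + D + y.2 + 2
  have hterms : Computable terms :=
    hN.comp Computable.fst (Computable.succ.comp Computable.snd)
  have hlevel : Computable level := computable_add (computable_add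
    (computable_add hterms (Computable.const D)) Computable.snd) (Computable.const 2)
  have hI' : ComputableIntervals fun z : (ℕ × ℕ) × ℕ => I z.1.1 z.2 :=
    hI.comp ((Computable.fst.comp Computable.fst).pair Computable.snd)
  refine ComputableRat.uniformlyComputable (q := fun n i =>
    ((coveredCells (I n) (terms (n, i)) (level (n, i))).card : ℚ) / 2 ^ level (n, i))
    (computableRat_natCast_div_two_pow (computable_card_coveredCells hI' hterms hlevel) hlevel)
    fun n i => ?_
  have hsub (k : ℕ) : I n k ⊆ Set.Ioc (-(level (n, i) : ℝ)) (level (n, i)) := by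
    have hle : (D : ℝ) ≤ level (n, i) := Nat.cast_le.2 (by simp only [level]; omega)
    exact (hD n k).trans (Set.Ioc_subset_Ioc (neg_le_neg hle) hle)
  have htail := hIN n (i + 1)
  have hgrid : |volume.real (⋃ k ∈ Finset.range (terms (n, i)), I n k) -
      (coveredCells (I n) (terms (n, i)) (level (n, i))).card / 2 ^ level (n, i)| ≤
      2⁻¹ ^ (i + 1) := by
    obtain ⟨l, r, -, -, hIoo⟩ := hI
    have hIn : I n = fun k => Set.Ioo (l (n, k) : ℝ) (r (n, k)) := funext fun k => hIoo (n, k)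
    rw [hIn] at hsub ⊢
    exact (abs_volume_real_sub_card_coveredCells_le fun k _ => hsub k).trans
      (two_mul_div_two_pow_le (by simp only [level]; omega))
  have hmono : volume.real (⋃ k ∈ Finset.range (terms (n, i)), I n k) ≤
      volume.real (⋃ k, I n k) :=
    measureReal_mono (Set.iUnion₂_subset fun k _ => Set.subset_iUnion (I n) k)
      (measure_ne_top_of_subset (Set.iUnion_subset (hD n)) measure_Ioc_lt_top.ne)
  have hpow : (2⁻¹ : ℝ) ^ i = 2⁻¹ ^ (i + 1) + 2⁻¹ ^ (i + 1) := by ring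
  push_cast
  rw [abs_le] at hgrid ⊢
  simp only [terms] at *
  constructor <;> linarith

end UniformlyComputable

/-! ### Covers of Lipschitz images -/

section ImageCover

/-- The piece of `imageCover I C g` that comes from the cell whose level `s` and index are paired
in `e`. -/
def imagePiece (I : ℕ → Set ℝ) (C : ℕ) (g : ℕ →. ℕ) (e : ℕ) : Set ℝ :=
  {y | CellMaximal I e.unpair.1 e.unpair.2 ∧
    ∃ v ∈ g e, y ∈ Metric.ball (ratOfCode v : ℝ) (C / 2 ^ e.unpair.1)}

/-- A cover of the image of `⋃ k, I k` under a Lipschitz function whose value at a sample point of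
the cell coded by `e` is approximated by the rational with code `g e`: each maximal cell, of
length `1 / 2 ^ s`, contributes the interval of radius `C / 2 ^ s` around that rational. -/
def imageCover (I : ℕ → Set ℝ) (C : ℕ) (g : ℕ →. ℕ) : Set ℝ :=
  ⋃ e, imagePiece I C g e

variable {C : ℕ}

theorem mem_imageCover {I : ℕ → Set ℝ} (hI : ∀ k, IsOpen (I k)) {g : ℕ →. ℕ} {x y : ℝ}
    (hx : x ∈ ⋃ k, I k) (hg : ∀ s j, x ∈ cell s j →
      ∃ v ∈ g (Nat.pair s j), y ∈ Metric.ball (ratOfCode v : ℝ) (C / 2 ^ s)) :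
    y ∈ imageCover I C g := by
  obtain ⟨s, j, hmax, hxj⟩ := exists_cellMaximal hI hx
  refine Set.mem_iUnion.2 ⟨Nat.pair s j, ?_⟩
  simp only [imagePiece, Nat.unpair_pair]
  exact ⟨hmax, hg s j hxj⟩

theorem imagePiece_subset_ball {I : ℕ → Set ℝ} {g : ℕ →. ℕ} {e v : ℕ} (hv : v ∈ g e) :
    imagePiece I C g e ⊆ Metric.ball (ratOfCode v : ℝ) (C / 2 ^ e.unpair.1) := by
  rintro y ⟨-, w, hw, hy⟩
  rwa [Part.mem_unique hv hw]

theorem volume_imagePiece_le (I : ℕ → Set ℝ) (C : ℕ) (g : ℕ →. ℕ) (e : ℕ) :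
    volume (imagePiece I C g e) ≤ (2 * C : ℕ) * volume (maximalCell I e) := by
  rcases (imagePiece I C g e).eq_empty_or_nonempty with hempty | ⟨y, hmax, v, hv, -⟩
  · rw [hempty, measure_empty]
    exact zero_le
  · refine (measure_mono (imagePiece_subset_ball hv)).trans_eq ?_
    rw [maximalCell_of_maximal hmax, Real.volume_ball, cell, Real.volume_Ioc, add_sub_cancel_left,
      ← ENNReal.ofReal_natCast, ← ENNReal.ofReal_mul (Nat.cast_nonneg _)]
    congr 1
    push_cast
    ring

theorem volume_imageCover_le {I : ℕ → Set ℝ} (hI : ∀ k, IsOpen (I k)) (g : ℕ →. ℕ) :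
    volume (imageCover I C g) ≤ (2 * C : ℕ) * volume (⋃ k, I k) := by
  rw [← iUnion_maximalCell hI]
  exact measure_iUnion_le_mul (measurableSet_maximalCell I) (pairwise_disjoint_maximalCell I)
    (volume_imagePiece_le I C g)

theorem computableIntervals_ball {α : Type*} [Primcodable α] {p ρ : α → ℚ}
    (hp : ComputableRat p) (hρ : ComputableRat ρ) :
    ComputableIntervals fun a => Metric.ball (p a : ℝ) (ρ a) :=
  ⟨_, _, hp.sub hρ, hp.add hρ, fun a => by
    beta_reduce
    rw [Real.ball_eq_Ioo, Rat.cast_sub, Rat.cast_add]⟩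

theorem ComputableIntervals.setOf_and {α : Type*} [Primcodable α] {I : α → Set ℝ}
    (hI : ComputableIntervals I) {P : α → Prop} (hP : ComputablePred P) :
    ComputableIntervals fun a => {y | P a ∧ y ∈ I a} := by
  classical
  obtain ⟨l, r, hl, hr, hIoo⟩ := hI
  refine ⟨_, _, hl.ite hP (computableRat_const 0), hr.ite hP (computableRat_const 0), fun a => ?_⟩
  by_cases ha : P a
  · simp only [ha, true_and, Set.ofPred_mem_eq, hIoo, if_true]
  · simp only [ha, false_and, Set.ofPred_false, if_false, Set.Ioo_self]

variable {I : ℕ → ℕ → Set ℝ}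

theorem computablePred_cellMaximal_unpair (hI : ComputableIntervals fun x : ℕ × ℕ => I x.1 x.2)
    {α : Type*} [Primcodable α] {n e : α → ℕ} (hn : Computable n) (he : Computable e) :
    ComputablePred fun a => CellMaximal (I (n a)) (e a).unpair.1 (e a).unpair.2 :=
  computablePred_cellMaximal (hI.comp ((hn.comp Computable.fst).pair Computable.snd))
    (computable_unpair_fst he) (computable_unpair_snd he)

theorem uniformlyCEOpen_imageCover (hI : ComputableIntervals fun x : ℕ × ℕ => I x.1 x.2) (C : ℕ)
    {g : ℕ →. ℕ} (hg : Partrec g) : UniformlyCEOpen fun n => imageCover (I n) C g := by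
  obtain ⟨stage, hstage, mem_g_iff⟩ := exists_computable_stages hg
  let value (k : ℕ) : Option ℕ := stage k.unpair.1 k.unpair.2
  have hcell : Computable fun x : ℕ × ℕ => x.2.unpair.1 := computable_unpair_fst Computable.snd
  have hvalue : Computable fun x : ℕ × ℕ => value x.2 :=
    hstage.comp hcell (computable_unpair_snd Computable.snd)
  have hsome : ComputablePred fun x : ℕ × ℕ => (value x.2).isSome :=
    ComputablePred.computable_iff.2 ⟨_, Primrec.option_isSome.to_comp.comp hvalue, rfl⟩
  refine uniformlyCEOpen_iff.2 ⟨fun n k => {y | (CellMaximal (I n) k.unpair.1.unpair.1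
    k.unpair.1.unpair.2 ∧ (value k).isSome) ∧ y ∈ Metric.ball (ratOfCode ((value k).getD 0) : ℝ)
      ((C / 2 ^ k.unpair.1.unpair.1 : ℚ) : ℝ)},
    (computableIntervals_ball (computableRat_ratOfCode (hvalue.option_getD (Computable.const 0)))
      (computableRat_natCast_div_two_pow (Computable.const C)
        (computable_unpair_fst hcell))).setOf_and
      (computablePred_and (computablePred_cellMaximal_unpair hI Computable.fst hcell) hsome),
    fun n => Set.ext fun y => ?_⟩
  push_cast
  simp only [imageCover, imagePiece, Set.mem_iUnion, Set.mem_ofPred_eq]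
  constructor
  · rintro ⟨e, hmax, v, hv, hy⟩
    obtain ⟨t, ht⟩ := (mem_g_iff e v).1 hv
    have hval : value (Nat.pair e t) = some v := by simp only [value, Nat.unpair_pair, ht]
    exact ⟨Nat.pair e t, by simp only [hval, Nat.unpair_pair]; exact ⟨⟨hmax, rfl⟩, hy⟩⟩
  · rintro ⟨k, ⟨hmax, hk⟩, hy⟩
    obtain ⟨v, hv⟩ := Option.isSome_iff_exists.1 hk
    rw [hv, Option.getD_some] at hy
    exact ⟨k.unpair.1, hmax, v, (mem_g_iff _ v).2 ⟨_, hv⟩, hy⟩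

theorem isMartinLofTest_imageCover (hI : ComputableIntervals fun x : ℕ × ℕ => I x.1 x.2)
    (hμ : ∀ n, volume (⋃ k, I n k) ≤ 2⁻¹ ^ n) (C : ℕ) {g : ℕ →. ℕ} (hg : Partrec g) :
    IsMartinLofTest fun n => imageCover (I (n + 2 * C)) C g := by
  refine ⟨uniformlyCEOpen_imageCover (I := fun n => I (n + 2 * C)) (hI.comp ((computable_add
    Computable.fst (Computable.const (2 * C))).pair Computable.snd)) C hg, fun n => ?_⟩
  exact (volume_imageCover_le (fun k => hI.isOpen (n + 2 * C, k)) g).trans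
    (natCast_mul_le_pow_of_two_mul_eq_one zero_le
      (ENNReal.mul_inv_cancel two_ne_zero ENNReal.ofNat_ne_top) (hμ _))

theorem imagePiece_coe (I : ℕ → Set ℝ) (C : ℕ) (γ : ℕ → ℕ) (e : ℕ) :
    imagePiece I C γ e = {y | CellMaximal I e.unpair.1 e.unpair.2 ∧
      y ∈ Metric.ball (ratOfCode (γ e) : ℝ) (C / 2 ^ e.unpair.1)} := by
  simp only [imagePiece, PFun.coe_val, Part.mem_some_iff, exists_eq_left]

theorem computableIntervals_imagePiece (hI : ComputableIntervals fun x : ℕ × ℕ => I x.1 x.2)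
    (C : ℕ) {γ : ℕ → ℕ} (hγ : Computable γ) :
    ComputableIntervals fun x : ℕ × ℕ => imagePiece (I x.1) C γ x.2 := by
  simp only [imagePiece_coe]
  have hball := computableIntervals_ball
    (computableRat_ratOfCode (hγ.comp (Computable.snd (α := ℕ))))
    (computableRat_natCast_div_two_pow (Computable.const C) (computable_unpair_fst Computable.snd))
  push_cast at hball
  exact hball.setOf_and (computablePred_cellMaximal_unpair hI Computable.fst Computable.snd)

theorem imagePiece_subset_Ioc (I : ℕ → Set ℝ) (C : ℕ) {γ : ℕ → ℕ} {B : ℕ}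
    (hγ : ∀ e, |(ratOfCode (γ e) : ℝ)| ≤ B) (e : ℕ) :
    imagePiece I C γ e ⊆ Set.Ioc (-((B + C : ℕ) : ℝ)) (B + C : ℕ) := by
  have hmem : γ e ∈ (γ : ℕ →. ℕ) e := Part.mem_some (γ e)
  refine (imagePiece_subset_ball hmem).trans ?_
  rw [Real.ball_eq_Ioo]
  have hradius : (C / 2 ^ e.unpair.1 : ℝ) ≤ C :=
    div_le_self C.cast_nonneg (one_le_pow₀ one_le_two)
  obtain ⟨hleft, hright⟩ := abs_le.1 (hγ e)
  push_cast
  exact Set.Ioo_subset_Ioc_self.trans (Set.Ioc_subset_Ioc (by linarith) (by linarith))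

theorem computableRat_sum_maximalLength (hI : ComputableIntervals fun x : ℕ × ℕ => I x.1 x.2) :
    ComputableRat fun x : ℕ × ℕ => ∑ e ∈ Finset.range x.2, maximalLength (I x.1) e := by
  have hI' : ComputableIntervals fun z : ((ℕ × ℕ) × ℕ) × ℕ => I z.1.1.1 z.2 := hI.comp
    ((Computable.fst.comp (Computable.fst.comp Computable.fst)).pair Computable.snd)
  exact ComputableRat.sum_range Computable.snd (computableRat_maximalLength hI' Computable.snd)

theorem tendsto_sum_maximalLength {I : ℕ → Set ℝ} (hI : ∀ k, IsOpen (I k))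
    (hfin : volume (⋃ k, I k) ≠ ⊤) :
    Tendsto (fun N => ((∑ e ∈ Finset.range N, maximalLength I e : ℚ) : ℝ)) atTop
      (𝓝 (volume.real (⋃ k, I k))) := by
  rw [← iUnion_maximalCell hI] at hfin ⊢
  simp only [Rat.cast_sum, ← volume_real_maximalCell]
  exact (hasSum_measureReal_iUnion (measurableSet_maximalCell I)
    (pairwise_disjoint_maximalCell I) hfin).tendsto_sum_nat

theorem volume_real_imageCover_sub_le {I : ℕ → Set ℝ} (hI : ∀ k, IsOpen (I k))
    (hfin : volume (⋃ k, I k) ≠ ⊤) (C : ℕ) (g : ℕ →. ℕ) (N : ℕ) :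
    volume.real (imageCover I C g) - volume.real (⋃ e ∈ Finset.range N, imagePiece I C g e) ≤
      (2 * C : ℕ) * (volume.real (⋃ k, I k) -
        (∑ e ∈ Finset.range N, maximalLength I e : ℚ)) := by
  rw [← iUnion_maximalCell hI] at hfin
  have hle := measureReal_iUnion_sub_le (C := (2 * C : ℕ)) (measurableSet_maximalCell I)
    (pairwise_disjoint_maximalCell I) hfin
    (by simpa only [ENNReal.coe_natCast] using volume_imagePiece_le I C g) N
  rw [iUnion_maximalCell hI, NNReal.coe_natCast] at hle
  simpa only [imageCover, Rat.cast_sum, ← volume_real_maximalCell] using hle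

theorem uniformlyComputable_volume_imageCover
    (hI : ComputableIntervals fun x : ℕ × ℕ => I x.1 x.2) (hfin : ∀ n, volume (⋃ k, I n k) ≠ ⊤)
    (hμ : UniformlyComputable fun n => volume.real (⋃ k, I n k)) (C : ℕ) {γ : ℕ → ℕ}
    (hγ : Computable γ) {B : ℕ} (hB : ∀ e, |(ratOfCode (γ e) : ℝ)| ≤ B) :
    UniformlyComputable fun n => volume.real (imageCover (I n) C γ) := by
  have hopen (n k : ℕ) : IsOpen (I n k) := hI.isOpen (n, k)
  obtain ⟨N, hN, hN_le⟩ := hμ.exists_computable_modulus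
    (q := fun n N => ∑ e ∈ Finset.range N, maximalLength (I n) e)
    (computableRat_sum_maximalLength hI) fun n => tendsto_sum_maximalLength (hopen n) (hfin n)
  refine uniformlyComputable_volume_iUnion (computableIntervals_imagePiece hI C hγ)
    (fun n => imagePiece_subset_Ioc (I n) C hB) (N := fun n i => N n (i + 2 * C))
    (hN.comp Computable.fst (computable_add Computable.snd (Computable.const (2 * C))))
    fun n i => (volume_real_imageCover_sub_le (hopen n) (hfin n) C γ _).trans ?_
  exact natCast_mul_le_pow_of_two_mul_eq_one (by positivity) (mul_inv_cancel₀ two_ne_zero)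
    (hN_le n (i + 2 * C))

theorem isSchnorrTest_imageCover (hI : ComputableIntervals fun x : ℕ × ℕ => I x.1 x.2)
    (hμ : ∀ n, volume (⋃ k, I n k) ≤ 2⁻¹ ^ n)
    (hcomp : UniformlyComputable fun n => volume.real (⋃ k, I n k)) (C : ℕ) {γ : ℕ → ℕ}
    (hγ : Computable γ) {B : ℕ} (hB : ∀ e, |(ratOfCode (γ e) : ℝ)| ≤ B) :
    IsSchnorrTest fun n => imageCover (I (n + 2 * C)) C γ := by
  have hshift : Computable fun n => n + 2 * C :=
    computable_add Computable.id (Computable.const (2 * C))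
  refine ⟨isMartinLofTest_imageCover hI hμ C hγ.partrec, uniformlyComputable_volume_imageCover
    (I := fun n => I (n + 2 * C)) (hI.comp ((hshift.comp Computable.fst).pair Computable.snd))
    (fun n => ne_top_of_le_ne_top ?_ (hμ _)) (hcomp.comp hshift) C hγ hB⟩
  exact ENNReal.pow_ne_top (ENNReal.inv_ne_top.2 two_ne_zero)

end ImageCover

/-! ### Transfer of non-randomness -/

section Reducibility

variable {f : ℝ → ℝ} {K : ℕ} {s j : ℕ} {x y : ℝ}

theorem dist_max_cellLeft_le (hx : x ∈ cell s j) (hx0 : 0 ≤ x) :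
    dist ((max (cellLeft s j) 0 : ℚ) : ℝ) x ≤ 1 / 2 ^ s := by
  have hle : max (cellLeft s j : ℝ) 0 ≤ x := max_le hx.1.le hx0
  rw [dist_comm, Real.dist_eq, Rat.cast_max, Rat.cast_zero, abs_of_nonneg (sub_nonneg.2 hle)]
  linarith [hx.2, le_max_left (cellLeft s j : ℝ) 0]

theorem mem_ball_of_approx {p v : ℝ} (hp : dist p x ≤ 1 / 2 ^ s)
    (hv : |v - f p| ≤ 2 / 2 ^ s) (hf : dist (f p) y ≤ K * dist p x) :
    y ∈ Metric.ball v ((K + 3 : ℕ) / 2 ^ s) := by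
  have hK : K * dist p x ≤ K * (1 / 2 ^ s) := by gcongr
  have hpos : (0 : ℝ) < 1 / 2 ^ s := by positivity
  rw [Metric.mem_ball, dist_comm]
  calc dist v y ≤ dist v (f p) + dist (f p) y := dist_triangle _ _ _
    _ ≤ 2 / 2 ^ s + K * (1 / 2 ^ s) := add_le_add hv (hf.trans hK)
    _ < 2 / 2 ^ s + K * (1 / 2 ^ s) + 1 / 2 ^ s := lt_add_of_pos_right _ hpos
    _ = (K + 3 : ℕ) / 2 ^ s := by
      push_cast
      ring

theorem exists_natCast_lipschitzOnWith {X Y : Type*} [PseudoEMetricSpace X] [PseudoEMetricSpace Y]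
    {f : X → Y} {K : ℝ≥0} {s : Set X} (hf : LipschitzOnWith K f s) :
    ∃ n : ℕ, LipschitzOnWith n f s := by
  obtain ⟨n, hn⟩ := exists_nat_ge K
  exact ⟨n, hf.weaken hn⟩

theorem dist_le_mul_of_lipschitzOnWith_of_tendsto {X Y : Type*} [PseudoMetricSpace X]
    [PseudoMetricSpace Y] {f : X → Y} {K : ℝ≥0} {s : Set X} {l : Filter X} [l.NeBot] {a : Y}
    {b x : X} (hf : LipschitzOnWith K f s) (hl : l ≤ 𝓝 b) (hls : s ∈ l)
    (ha : Tendsto f l (𝓝 a)) (hx : x ∈ s) : dist (f x) a ≤ K * dist x b :=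
  le_of_tendsto_of_tendsto (tendsto_const_nhds.dist ha)
    ((tendsto_const_nhds.dist (tendsto_id.mono_left hl)).const_mul (K : ℝ))
    (mem_of_superset hls fun y hy => hf.dist_le_mul x hx y hy)

theorem computableRat_cellLeft_unpair :
    ComputableRat fun e : ℕ => cellLeft e.unpair.1 e.unpair.2 :=
  computableRat_cellLeft (computable_unpair_fst Computable.id) (computable_unpair_snd Computable.id)

theorem not_martinLofRandom_of_clOpenReducible {α β : ℝ} (hβ : 0 < β)
    (h : ClOpenReducible α β) (hr : ¬ MartinLofRandom β) : ¬ MartinLofRandom α := by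
  obtain ⟨f, ⟨hf, hlim⟩, K₀, hK₀⟩ := h
  obtain ⟨K, hK⟩ := exists_natCast_lipschitzOnWith hK₀
  simp only [MartinLofRandom, not_forall, not_not] at hr ⊢
  obtain ⟨U, ⟨hU, hμ⟩, hβU⟩ := hr
  obtain ⟨I, hI, hUI⟩ := uniformlyCEOpen_iff.1 hU
  simp only [hUI] at hμ hβU
  obtain ⟨g, hg, hgf⟩ := hf.exists_partrec_approx
    (computableRat_cellLeft_unpair.max (computableRat_const 0)) (k := fun e => e.unpair.1)
    (computable_unpair_fst Computable.id)
  refine ⟨_, isMartinLofTest_imageCover hI hμ (K + 3) hg, Set.mem_iInter.2 fun n =>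
    mem_imageCover (fun k => hI.isOpen (_, k)) (Set.mem_iInter.1 hβU (n + 2 * (K + 3)))
      fun s j hj => ?_⟩
  have hp : ((max (cellLeft s j) 0 : ℚ) : ℝ) ∈ Set.Ico 0 β := by
    rw [Rat.cast_max, Rat.cast_zero]
    exact ⟨le_max_right _ _, max_lt hj.1 hβ⟩
  have hgf' := hgf (Nat.pair s j)
  simp only [Nat.unpair_pair] at hgf'
  obtain ⟨v, hv, hvf⟩ := hgf' hp
  exact ⟨v, hv, mem_ball_of_approx (dist_max_cellLeft_le hj hβ.le) hvf
    (dist_le_mul_of_lipschitzOnWith_of_tendsto hK nhdsWithin_le_nhds (Ico_mem_nhdsLT hβ) hlim hp)⟩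

theorem ComputableRealOn.exists_computable_bounded_approx {X : Set ℝ} (hf : ComputableRealOn f X)
    {B : ℝ} (hB : ∀ x ∈ X, ‖f x‖ ≤ B) {α : Type*} [Primcodable α] {p : α → ℚ}
    (hp : ComputableRat p) (hpX : ∀ a, (p a : ℝ) ∈ X) {k : α → ℕ} (hk : Computable k) :
    ∃ γ : α → ℕ, Computable γ ∧ (∀ a, |(ratOfCode (γ a) : ℝ) - f (p a)| ≤ 2 / 2 ^ k a) ∧
      ∃ D : ℕ, ∀ a, |(ratOfCode (γ a) : ℝ)| ≤ D := by
  obtain ⟨g, hg, hgf⟩ := hf.exists_partrec_approx hp hk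
  choose γ hγg hγf using fun a => hgf a (hpX a)
  obtain ⟨D, hD⟩ := exists_nat_ge (B + 2)
  refine ⟨γ, hg.of_eq_tot hγg, hγf, D, fun a => ?_⟩
  have htwo : (2 / 2 ^ k a : ℝ) ≤ 2 := div_le_self zero_le_two (one_le_pow₀ one_le_two)
  have htri := abs_sub_abs_le_abs_sub (ratOfCode (γ a) : ℝ) (f (p a))
  linarith [hγf a, hB _ (hpX a), Real.norm_eq_abs (f (p a))]

theorem not_schnorrRandom_of_clLocReducible {α β : ℝ} (hβ : 0 ≤ β)
    (h : ClLocReducible α β) (hr : ¬ SchnorrRandom β) : ¬ SchnorrRandom α := by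
  obtain ⟨b, hb, f, hf, ⟨K₀, hK₀⟩, rfl⟩ := h
  obtain ⟨K, hK⟩ := exists_natCast_lipschitzOnWith hK₀
  obtain ⟨q, hβq, hqb⟩ := exists_rat_btwn hb
  simp only [SchnorrRandom, not_forall, not_not] at hr ⊢
  obtain ⟨U, ⟨⟨hU, hμ⟩, hcomp⟩, hβU⟩ := hr
  obtain ⟨I, hI, hUI⟩ := uniformlyCEOpen_iff.1 hU
  simp only [hUI] at hμ hcomp hβU
  let p (e : ℕ) : ℚ := min (max (cellLeft e.unpair.1 e.unpair.2) 0) q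
  have hp : ComputableRat p :=
    (computableRat_cellLeft_unpair.max (computableRat_const 0)).min (computableRat_const q)
  have hpb (e : ℕ) : (p e : ℝ) ∈ Set.Icc 0 b := by
    simp only [p, Rat.cast_min, Rat.cast_max, Rat.cast_zero]
    exact ⟨le_min (le_max_right _ _) (hβ.trans hβq.le), (min_le_right _ _).trans hqb.le⟩
  obtain ⟨B, hB⟩ := isCompact_Icc.exists_bound_of_continuousOn hK.continuousOn
  obtain ⟨γ, hγ, hγf, D, hD⟩ := hf.exists_computable_bounded_approx hB hp hpb
    (k := fun e => e.unpair.1) (computable_unpair_fst Computable.id)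
  refine ⟨_, isSchnorrTest_imageCover hI hμ hcomp (K + 3) hγ hD, Set.mem_iInter.2 fun n =>
    mem_imageCover (fun k => hI.isOpen (_, k)) (Set.mem_iInter.1 hβU (n + 2 * (K + 3)))
      fun s j hj => ?_⟩
  have hclip : p (Nat.pair s j) = max (cellLeft s j) 0 := by
    simp only [p, Nat.unpair_pair]
    refine min_eq_left ?_
    rw [← Rat.cast_le (K := ℝ), Rat.cast_max, Rat.cast_zero]
    exact (max_le hj.1.le hβ).trans hβq.le
  have happrox := hγf (Nat.pair s j)
  rw [Nat.unpair_pair] at happrox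
  exact ⟨_, Part.mem_some _, mem_ball_of_approx (hclip ▸ dist_max_cellLeft_le hj hβ) happrox
    (hK.dist_le_mul _ (hpb _) _ ⟨hβ, hb.le⟩)⟩

end Reducibility

end SolovayVariants

theorem mainTheorem6 :
    (∀ α β : ℝ, 0 < β → SolovayVariants.ClOpenReducible α β →
      ¬ SolovayVariants.MartinLofRandom β → ¬ SolovayVariants.MartinLofRandom α) ∧
    (∀ α β : ℝ, 0 ≤ β → SolovayVariants.ClLocReducible α β →
      ¬ SolovayVariants.SchnorrRandom β → ¬ SolovayVariants.SchnorrRandom α) :=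
  ⟨fun _ _ => SolovayVariants.not_martinLofRandom_of_clOpenReducible,
    fun _ _ => SolovayVariants.not_schnorrRandom_of_clLocReducible⟩
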